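/- For integers $k\ge 2$ and $n\ge 1$, a set $C\subseteq\{1,\dots,k\}^n$ is called a perfect $k$-hash code of length $n$ if for any $k$ distinct elements of $C$ there exists a coordinate in which they are pairwise different. Let $N_k(n)$ be the largest cardinality of a perfect $k$-hash code of length $n$, and put $$R_k=\limsup_{n\to\infty}\frac{\log_2 N_k(n)}{n}.$$ Then $R_5\le 0.1697$ and $R_6\le 0.0875$. -/

import Mathlib

/-- A set `C` of words of length `n` over an alphabet of size `k` is a perfect `k`-hash code if
for any `k` distinct elements of `C` there is a coordinate where they all differ. -/
def IsPerfectHash (k n : ℕ) (C : Finset (Fin n → Fin k)) : Prop :=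
  ∀ x : Fin k → (Fin n → Fin k), Function.Injective x → (∀ j, x j ∈ C) →
    ∃ i : Fin n, Function.Injective (fun j => x j i)

open Classical in
/-- The largest cardinality of a perfect `k`-hash code of length `n`. -/
noncomputable def maxHashSize (k n : ℕ) : ℕ :=
  (Finset.univ.filter (IsPerfectHash k n)).sup Finset.card

/-- The rate (with logarithm in base two) of the largest perfect `k`-hash codes of length `n`. -/
noncomputable def maxHashRate (k n : ℕ) : ℝ :=
  Real.logb 2 (maxHashSize k n : ℝ) / (n : ℝ)

/-- `R_k`: the limsup, as the length tends to infinity, of the rate of the largest perfect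
`k`-hash codes. The sequence is bounded (see `maxHashRate_nonneg` and `maxHashRate_le`), so this
real-valued `limsup` is the usual one. -/
noncomputable def hashRate (k : ℕ) : ℝ :=
  Filter.limsup (fun n : ℕ => maxHashRate k n) Filter.atTop

theorem maxHashRate_nonneg (k n : ℕ) : 0 ≤ maxHashRate k n := by
  unfold maxHashRate
  refine div_nonneg ?_ (Nat.cast_nonneg n)
  rcases Nat.eq_zero_or_pos (maxHashSize k n) with h | h
  · simp [h]
  · exact Real.logb_nonneg (by norm_num) (by exact_mod_cast h)

theorem maxHashSize_le (k n : ℕ) : maxHashSize k n ≤ k ^ n := by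
  unfold maxHashSize
  refine Finset.sup_le fun C _ => ?_
  simpa using Finset.card_le_univ C

theorem maxHashRate_le (k n : ℕ) : maxHashRate k n ≤ Real.logb 2 (k : ℝ) := by
  have hk : 0 ≤ Real.logb 2 (k : ℝ) := by
    rcases Nat.eq_zero_or_pos k with h | h
    · simp [h]
    · exact Real.logb_nonneg (by norm_num) (by exact_mod_cast h)
  unfold maxHashRate
  rcases Nat.eq_zero_or_pos n with hn | hn
  · simpa [hn] using hk
  rcases Nat.eq_zero_or_pos (maxHashSize k n) with h | h
  · simpa [h] using hk
  have hn' : (0 : ℝ) < n := by exact_mod_cast hn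
  rw [div_le_iff₀ hn', mul_comm, ← Real.logb_pow]
  refine Real.logb_le_logb_of_le (by norm_num) (by exact_mod_cast h) ?_
  exact_mod_cast maxHashSize_le k n

/-!
Let `k = m + 2` and fix `m` words of a perfect `k`-hash code `C`. The coordinates where they are
pairwise different colour the remaining words partially with two colours, and any two of these words
get opposite colours somewhere, so Hansel's lemma makes `(#C - m) * log₂ (#C - m)` a lower bound for
the number of coloured pairs of a word and a coordinate. Average this over the `m`-tuples of words
of a subcode `B ⊆ C`: a coordinate colours a proportion `hashForm m p q` of the words of `C` on
average, where `p` and `q` are the symbol frequencies of `B` and `C` there.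

Restrict a fraction `θ` of the coordinates, in all possible ways, to symbol sets from a family `𝒮`
of sets with fewer than `m` elements, `D` of which contain any given symbol. In the resulting
subcodes `B` these coordinates colour nothing, at the price that `B` is on average smaller than `C`
by the factor `(#𝒮 / D) ^ (θ * n)`. At the other coordinates the distributions `p` average to `q`,
and the mean of `hashForm m p q` is at most its value `M` at the uniform distribution. The rate is
therefore at most the larger of `θ * log₂ (#𝒮 / D)` and `(1 - θ) * M`, and `θ` is chosen to balance
the two.
-/

open Finset

section ElementarySymmetric

variable {ι R : Type*}

/-- The elementary symmetric polynomial of degree `j` in the values `p a`, `a ∈ s`; the index set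
is a `Finset` because the argument keeps deleting indices from it. -/
def esymmOn [CommSemiring R] (s : Finset ι) (p : ι → R) (j : ℕ) : R :=
  (s.val.map p).esymm j

theorem esymmOn_eq_sum_prod [CommSemiring R] (s : Finset ι) (p : ι → R) (j : ℕ) :
    esymmOn s p j = ∑ T ∈ s.powersetCard j, ∏ a ∈ T, p a :=
  s.esymm_map_val p j

@[simp]
theorem esymmOn_zero [CommSemiring R] (s : Finset ι) (p : ι → R) : esymmOn s p 0 = 1 := by
  simp [esymmOn_eq_sum_prod]

@[simp]
theorem esymmOn_one [CommSemiring R] (s : Finset ι) (p : ι → R) :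
    esymmOn s p 1 = ∑ a ∈ s, p a := by
  simp [esymmOn_eq_sum_prod, powersetCard_one]

theorem esymmOn_nonneg {s : Finset ι} {p : ι → ℝ} (hp : ∀ a ∈ s, 0 ≤ p a) (j : ℕ) :
    0 ≤ esymmOn s p j := by
  rw [esymmOn_eq_sum_prod]
  exact sum_nonneg fun T hT ↦ prod_nonneg fun a ha ↦ hp a ((mem_powersetCard.1 hT).1 ha)

variable [DecidableEq ι]

theorem esymmOn_succ [CommSemiring R] {s : Finset ι} {a : ι} (ha : a ∈ s) (p : ι → R) (j : ℕ) :
    esymmOn s p (j + 1) = p a * esymmOn (s.erase a) p j + esymmOn (s.erase a) p (j + 1) := by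
  have hval : s.val.map p = p a ::ₘ (s.erase a).val.map p := by
    rw [← Multiset.map_cons, ← insert_val_of_notMem (notMem_erase a s), insert_erase ha]
  rw [esymmOn, hval]
  simp [esymmOn, Multiset.esymm, Multiset.powersetCard_cons, add_comm, Multiset.sum_map_mul_left]

section CommRing

variable [CommRing R] (s : Finset ι) (p : ι → R) (j : ℕ)

theorem sum_esymmOn_erase :
    ∑ a ∈ s, esymmOn (s.erase a) p j = (#s - j) * esymmOn s p j := by
  have hswap : ∑ a ∈ s, esymmOn (s.erase a) p j =
      ∑ T ∈ s.powersetCard j, ∑ _a ∈ s \ T, ∏ b ∈ T, p b := by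
    simp only [esymmOn_eq_sum_prod]
    refine sum_comm' fun a T ↦ ?_
    simp only [mem_powersetCard, subset_erase, mem_sdiff]
    tauto
  rw [hswap, esymmOn_eq_sum_prod, mul_sum]
  refine sum_congr rfl fun T hT ↦ ?_
  obtain ⟨hTs, rfl⟩ := mem_powersetCard.1 hT
  rw [sum_const, nsmul_eq_mul, cast_card_sdiff hTs]

theorem sum_mul_esymmOn_erase :
    ∑ a ∈ s, p a * esymmOn (s.erase a) p j = (j + 1) * esymmOn s p (j + 1) := by
  have h : ∑ a ∈ s, p a * esymmOn (s.erase a) p j =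
      ∑ a ∈ s, (esymmOn s p (j + 1) - esymmOn (s.erase a) p (j + 1)) :=
    sum_congr rfl fun a ha ↦ by rw [esymmOn_succ ha]; ring
  rw [h, sum_sub_distrib, sum_esymmOn_erase, sum_const, nsmul_eq_mul]
  push_cast
  ring

variable {s} in
theorem sub_mul_esymmOn_erase_erase {a b : ι} (ha : a ∈ s) (hb : b ∈ s) (hab : a ≠ b) :
    (p a - p b) * esymmOn ((s.erase a).erase b) p j =
      esymmOn (s.erase b) p (j + 1) - esymmOn (s.erase a) p (j + 1) := by
  rw [esymmOn_succ (mem_erase.2 ⟨hab, ha⟩), esymmOn_succ (mem_erase.2 ⟨hab.symm, hb⟩),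
    erase_right_comm]
  ring

/-- The defect in Newton's inequality between consecutive elementary symmetric polynomials, as a
weighted sum of squares. -/
theorem sum_sum_sq_sub_mul_esymmOn_erase_erase :
    ∑ a ∈ s, ∑ b ∈ s, (p a - p b) ^ 2 * esymmOn ((s.erase a).erase b) p j =
      2 * ((#s - (j + 1)) * (∑ a ∈ s, p a) * esymmOn s p (j + 1) -
        #s * (j + 2) * esymmOn s p (j + 2)) := by
  have hterm : ∀ a ∈ s, ∀ b ∈ s, (p a - p b) ^ 2 * esymmOn ((s.erase a).erase b) p j =
      p a * esymmOn (s.erase b) p (j + 1) + p b * esymmOn (s.erase a) p (j + 1) -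
        (p a * esymmOn (s.erase a) p (j + 1) + p b * esymmOn (s.erase b) p (j + 1)) := by
    intro a ha b hb
    rcases eq_or_ne a b with rfl | hab
    · ring
    · rw [sq, mul_assoc, sub_mul_esymmOn_erase_erase p j ha hb hab]
      ring
  rw [sum_congr rfl fun a ha ↦ sum_congr rfl (hterm a ha)]
  simp only [sum_add_distrib, sum_sub_distrib, sum_const, nsmul_eq_mul]
  simp only [← mul_sum, ← sum_mul, sum_esymmOn_erase, sum_mul_esymmOn_erase]
  push_cast
  ring

end CommRing

theorem sum_injective_prod_eq_factorial_mul_esymmOn [Fintype ι] [CommRing R] (p : ι → R) (m : ℕ)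
    (s : Finset ι) :
    ∑ f : Fin m → ι with f.Injective ∧ ∀ j, f j ∈ s, ∏ j, p (f j) =
      m.factorial * esymmOn s p m := by
  induction m generalizing s with
  | zero => simp [Function.injective_of_subsingleton]
  | succ m ih =>
    rw [sum_filter, ← (Fin.consEquiv fun _ ↦ ι).sum_comp, Fintype.sum_prod_type]
    have hequiv (x : ι × (Fin m → ι)) : Fin.consEquiv (fun _ ↦ ι) x = Fin.cons x.1 x.2 := rfl
    have hcons (a : ι) (f : Fin m → ι) :
        ((Fin.cons a f : Fin (m + 1) → ι).Injective ∧
            ∀ j, (Fin.cons a f : Fin (m + 1) → ι) j ∈ s) ↔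
          a ∈ s ∧ f.Injective ∧ ∀ j, f j ∈ s.erase a := by
      simp only [Fin.cons_injective_iff, Fin.forall_fin_succ, Fin.cons_zero, Fin.cons_succ,
        mem_erase, Set.mem_range, not_exists, forall_and]
      tauto
    have hinner (a : ι) :
        (∑ f : Fin m → ι, if a ∈ s ∧ f.Injective ∧ ∀ j, f j ∈ s.erase a
          then p a * ∏ j, p (f j) else 0) =
        if a ∈ s then p a * (m.factorial * esymmOn (s.erase a) p m) else 0 := by
      split_ifs with ha
      · simp only [ha, true_and, ← sum_filter, ← mul_sum, ih]
      · simp [ha]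
    simp only [hequiv, hcons, Fin.prod_univ_succ, Fin.cons_zero, Fin.cons_succ,
      hinner, sum_ite_mem, univ_inter]
    calc ∑ a ∈ s, p a * (m.factorial * esymmOn (s.erase a) p m)
        = m.factorial * ∑ a ∈ s, p a * esymmOn (s.erase a) p m := by
          rw [mul_sum]; exact sum_congr rfl fun a _ ↦ by ring
      _ = (m + 1).factorial * esymmOn s p (m + 1) := by
          rw [sum_mul_esymmOn_erase, Nat.factorial_succ]; push_cast; ring

section Newton

variable {ι : Type*} {s : Finset ι} {p : ι → ℝ}

theorem newton_esymmOn_le (hp : ∀ a ∈ s, 0 ≤ p a) (j : ℕ) :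
    #s * (j + 2) * esymmOn s p (j + 2) ≤ (#s - (j + 1)) * (∑ a ∈ s, p a) * esymmOn s p (j + 1) := by
  classical
  have h := sum_sum_sq_sub_mul_esymmOn_erase_erase s p j
  have hnonneg : 0 ≤ ∑ a ∈ s, ∑ b ∈ s, (p a - p b) ^ 2 * esymmOn ((s.erase a).erase b) p j :=
    sum_nonneg fun a _ ↦ sum_nonneg fun b _ ↦ mul_nonneg (sq_nonneg _) <|
      esymmOn_nonneg (fun c hc ↦ hp c (mem_of_mem_erase (mem_of_mem_erase hc))) j
  linarith

theorem sq_sub_esymmOn_two_le (hs : #s = 3) (hp : ∀ a ∈ s, 0 ≤ p a) (hsum : ∑ a ∈ s, p a ≤ 1) :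
    (24 / 25 - 6 * esymmOn s p 2) ^ 2 ≤ 192 / 5 * (3 / 125 + 2 / 25 * ∑ a ∈ s, p a) := by
  have h₁ := sum_nonneg hp
  have h₂ := esymmOn_nonneg hp 2
  have hnewton := newton_esymmOn_le hp 0
  norm_num [hs] at hnewton
  have hle : 3 * esymmOn s p 2 ≤ ∑ a ∈ s, p a := by nlinarith
  have hquad : esymmOn s p 2 ^ 2 ≤ esymmOn s p 2 / 3 := by nlinarith
  linarith

theorem sq_sub_esymmOn_three_le (hs : #s = 4) (hp : ∀ a ∈ s, 0 ≤ p a) (hsum : ∑ a ∈ s, p a ≤ 1) :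
    (4 / 9 - 24 * esymmOn s p 3) ^ 2 ≤
      64 / 3 * (1 / 108 + 1 / 36 * ∑ a ∈ s, p a + 1 / 6 * esymmOn s p 2) := by
  have h₁ := sum_nonneg hp
  have h₂ := esymmOn_nonneg hp 2
  have h₃ := esymmOn_nonneg hp 3
  have hnewton₂ := newton_esymmOn_le hp 0
  have hnewton₃ := newton_esymmOn_le hp 1
  norm_num [hs] at hnewton₂ hnewton₃
  have hle₂ : 8 * esymmOn s p 2 ≤ 3 := by nlinarith
  have hle₃ : 6 * esymmOn s p 3 ≤ esymmOn s p 2 := by nlinarith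
  have hquad : esymmOn s p 3 ^ 2 ≤ esymmOn s p 3 / 16 := by nlinarith
  linarith

end Newton

end ElementarySymmetric

section Hansel

variable {α ι : Type*} [Fintype ι]

theorem sum_inv_two_pow_card_isSome_le_one (V : Finset α) (g : α → ι → Option Bool)
    (hg : ∀ y ∈ V, ∀ z ∈ V, y ≠ z → ∃ i b, g y i = some b ∧ g z i = some (!b)) :
    ∑ y ∈ V, ((2 : ℝ) ^ #{i | (g y i).isSome})⁻¹ ≤ 1 := by
  classical
  let subcube (y : α) : Finset (ι → Bool) :=
    Fintype.piFinset fun i ↦ {b | ∀ b', g y i = some b' → b = b'}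
  have hcard (y : α) :
      (#(subcube y) : ℝ) = 2 ^ Fintype.card ι * ((2 : ℝ) ^ #{i | (g y i).isSome})⁻¹ := by
    have hprod : #(subcube y) = ∏ i, if (g y i).isSome then 1 else 2 := by
      rw [Fintype.card_piFinset]
      refine prod_congr rfl fun i _ ↦ ?_
      cases h : g y i <;> simp [filter_eq']
    have hmul : #(subcube y) * 2 ^ #{i | (g y i).isSome} = 2 ^ Fintype.card ι := by
      rw [hprod, prod_ite, prod_const_one, one_mul, prod_const, ← pow_add, add_comm,
        card_filter_add_card_filter_not, card_univ]
    rw [eq_mul_inv_iff_mul_eq₀ (by positivity)]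
    exact_mod_cast hmul
  have hdisj : (V : Set α).PairwiseDisjoint subcube := by
    intro y hy z hz hyz
    rw [Function.onFun, disjoint_left]
    intro s hsy hsz
    obtain ⟨i, b, hyi, hzi⟩ := hg y hy z hz hyz
    simp only [subcube, Fintype.mem_piFinset, mem_filter_univ] at hsy hsz
    simpa using (hsy i b hyi).symm.trans (hsz i _ hzi)
  have htotal : ∑ y ∈ V, (#(subcube y) : ℝ) ≤ 2 ^ Fintype.card ι := by
    rw [← Nat.cast_sum, ← card_biUnion hdisj]
    exact_mod_cast (card_le_univ _).trans_eq (by simp)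
  simp only [hcard, ← mul_sum] at htotal
  exact le_of_mul_le_mul_left (by simpa using htotal) (by positivity : (0 : ℝ) < 2 ^ Fintype.card ι)

/-- Hansel's lemma: the labels `g · i` are partial two-colourings of `V`, that is, complete
bipartite graphs, and if they cover the complete graph on `V` then they have at least
`#V * log₂ #V` non-isolated vertices in total. -/
theorem card_mul_logb_card_le_sum_card_isSome (V : Finset α) (g : α → ι → Option Bool)
    (hg : ∀ y ∈ V, ∀ z ∈ V, y ≠ z → ∃ i b, g y i = some b ∧ g z i = some (!b)) :
    (#V : ℝ) * Real.logb 2 #V ≤ ∑ y ∈ V, (#{i | (g y i).isSome} : ℝ) := by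
  rcases V.eq_empty_or_nonempty with rfl | hV
  · simp
  have hVpos : (0 : ℝ) < #V := by exact_mod_cast hV.card_pos
  have hlog (y : α) : 1 + Real.log #V - #{i | (g y i).isSome} * Real.log 2 ≤
      #V * ((2 : ℝ) ^ #{i | (g y i).isSome})⁻¹ := by
    have h := Real.log_le_sub_one_of_pos
      (by positivity : (0 : ℝ) < #V * ((2 : ℝ) ^ #{i | (g y i).isSome})⁻¹)
    rw [Real.log_mul hVpos.ne' (by positivity), Real.log_inv, Real.log_pow] at h
    linarith
  have hsum : ∑ y ∈ V, (1 + Real.log #V - #{i | (g y i).isSome} * Real.log 2) ≤ #V := calc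
    _ ≤ ∑ y ∈ V, #V * ((2 : ℝ) ^ #{i | (g y i).isSome})⁻¹ := sum_le_sum fun y _ ↦ hlog y
    _ ≤ #V * 1 := by
      rw [← mul_sum]
      gcongr
      exact sum_inv_two_pow_card_isSome_le_one V g hg
    _ = #V := mul_one _
  simp only [sum_sub_distrib, sum_const, nsmul_eq_mul, ← sum_mul] at hsum
  rw [Real.logb, mul_div_assoc', div_le_iff₀ (Real.log_pos one_lt_two)]
  linarith

end Hansel

section PerfectHash

variable {m n : ℕ} {C : Finset (Fin n → Fin (m + 2))}

theorem IsPerfectHash.exists_injective_cons (hC : IsPerfectHash (m + 2) n C)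
    {x : Fin m → Fin n → Fin (m + 2)} (hx : x.Injective) (hxC : ∀ j, x j ∈ C)
    {y z : Fin n → Fin (m + 2)} (hy : y ∈ C) (hz : z ∈ C) (hyx : y ∉ Set.range x)
    (hzx : z ∉ Set.range x) (hyz : y ≠ z) :
    ∃ i, (Fin.cons (y i) (Fin.cons (z i) fun j ↦ x j i : Fin (m + 1) → Fin (m + 2)) :
      Fin (m + 2) → Fin (m + 2)).Injective := by
  let w : Fin (m + 2) → Fin n → Fin (m + 2) :=
    Fin.cons y (Fin.cons z x : Fin (m + 1) → Fin n → Fin (m + 2))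
  have hw : w.Injective := by
    simp only [w, Fin.cons_injective_iff, Set.mem_range, Fin.exists_fin_succ, Fin.cons_zero,
      Fin.cons_succ, not_or]
    exact ⟨⟨hyz.symm, hyx⟩, hzx, hx⟩
  have hwC : ∀ j, w j ∈ C := by
    simp only [w, Fin.forall_fin_succ, Fin.cons_zero, Fin.cons_succ]
    exact ⟨hy, hz, hxC⟩
  obtain ⟨i, hi⟩ := hC w hw hwC
  refine ⟨i, ?_⟩
  convert hi using 1
  ext j
  refine Fin.cases ?_ (fun j ↦ Fin.cases ?_ (fun j ↦ ?_) j) j <;> rfl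

/-- In each coordinate where the `x j` differ, the words avoiding the symbols of the `x j` use at
most two symbols there, and these two serve as the colours. -/
theorem IsPerfectHash.exists_partial_twoColorings (hC : IsPerfectHash (m + 2) n C)
    {x : Fin m → Fin n → Fin (m + 2)} (hx : x.Injective) (hxC : ∀ j, x j ∈ C) :
    ∃ g : (Fin n → Fin (m + 2)) → Fin n → Option Bool,
      (∀ y i, (g y i).isSome ↔ (fun j ↦ x j i).Injective ∧ ∀ j, x j i ≠ y i) ∧
      ∀ y ∈ C, y ∉ Set.range x → ∀ z ∈ C, z ∉ Set.range x → y ≠ z →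
        ∃ i b, g y i = some b ∧ g z i = some (!b) := by
  classical
  have hfresh (i : Fin n) : ∃ c, ∀ j, x j i ≠ c := by
    by_contra! h
    simpa using Fintype.card_le_of_surjective (fun j ↦ x j i) h
  choose c hc using hfresh
  refine ⟨fun y i ↦ if (fun j ↦ x j i).Injective ∧ ∀ j, x j i ≠ y i then
    some (decide (y i = c i)) else none, fun y i ↦ ?_, fun y hy hyx z hz hzx hyz ↦ ?_⟩
  · beta_reduce
    split_ifs with h <;> simp [h]
  · obtain ⟨i, hi⟩ := hC.exists_injective_cons hx hxC hy hz hyx hzx hyz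
    have hci := Finite.surjective_of_injective hi (c i)
    simp only [Fin.cons_injective_iff, Set.mem_range, Fin.exists_fin_succ, Fin.cons_zero,
      Fin.cons_succ, not_or, not_exists] at hi hci
    obtain ⟨⟨hne, hxy⟩, hxz, hinj⟩ := hi
    refine ⟨i, decide (y i = c i), if_pos ⟨hinj, hxy⟩, ?_⟩
    beta_reduce
    rw [if_pos ⟨hinj, hxz⟩]
    rcases hci with h | h | ⟨j, h⟩
    · simp [← h, hne]
    · simp [← h, Ne.symm hne]
    · exact absurd h (hc i j)

theorem IsPerfectHash.card_sub_mul_logb_le (hC : IsPerfectHash (m + 2) n C)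
    {x : Fin m → Fin n → Fin (m + 2)} (hx : x.Injective) (hxC : ∀ j, x j ∈ C) :
    ((#C : ℝ) - m) * Real.logb 2 (#C - m) ≤
      ∑ i, (#{y ∈ C | (fun j ↦ x j i).Injective ∧ ∀ j, x j i ≠ y i} : ℝ) := by
  classical
  obtain ⟨g, hsome, hg⟩ := hC.exists_partial_twoColorings hx hxC
  have hrange : univ.image x ⊆ C := by simpa [image_subset_iff] using hxC
  have hcard : (#(C \ univ.image x) : ℝ) = #C - m := by
    rw [cast_card_sdiff hrange, card_image_of_injective _ hx, card_univ, Fintype.card_fin]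
  have hcover : ∀ y ∈ C \ univ.image x, ∀ z ∈ C \ univ.image x, y ≠ z →
      ∃ i b, g y i = some b ∧ g z i = some (!b) := by
    intro y hy z hz
    simp only [mem_sdiff, mem_image, mem_univ, true_and] at hy hz
    exact hg y hy.1 hy.2 z hz.1 hz.2
  calc ((#C : ℝ) - m) * Real.logb 2 (#C - m)
      ≤ ∑ y ∈ C \ univ.image x, (#{i | (g y i).isSome} : ℝ) := by
        rw [← hcard]; exact card_mul_logb_card_le_sum_card_isSome _ g hcover
    _ ≤ ∑ y ∈ C, (#{i | (g y i).isSome} : ℝ) :=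
        sum_le_sum_of_subset_of_nonneg sdiff_subset fun _ _ _ ↦ Nat.cast_nonneg _
    _ = _ := by
        simp only [hsome]
        exact_mod_cast sum_card_bipartiteAbove_eq_sum_card_bipartiteBelow _

end PerfectHash

section HashForm

/-- The probability that `m` independent symbols of distribution `p` and one of distribution `q`
are pairwise distinct: classify by the symbol `a` of distribution `q`, and note that a set of `m`
symbols can be drawn in `m!` orders. -/
noncomputable def hashForm {ι : Type*} [Fintype ι] [DecidableEq ι] (m : ℕ) (p q : ι → ℝ) : ℝ :=
  m.factorial * ∑ a, q a * esymmOn (univ.erase a) p m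

variable {ι : Type*} [Fintype ι]

theorem sum_sum_sub_sq (v : ι → ℝ) :
    ∑ a, ∑ b, (v a - v b) ^ 2 = 2 * (Fintype.card ι * ∑ a, v a ^ 2 - (∑ a, v a) ^ 2) := by
  have hterm (a b : ι) : (v a - v b) ^ 2 = v a ^ 2 + v b ^ 2 - 2 * (v a * v b) := by ring
  simp only [hterm, sum_sub_distrib, sum_add_distrib, ← mul_sum, sum_const, card_univ,
    nsmul_eq_mul, ← sum_mul, sq (∑ a, v a)]
  ring

/-- The left side is a concave quadratic function of `q`; the bound is its maximum on the hyperplane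
`∑ a, q a = 1`, attained where `2 * α * q a - v a` does not depend on `a`. -/
theorem sum_mul_sub_mul_sum_sq_le [Nonempty ι] {α : ℝ} (hα : 0 < α) (v : ι → ℝ) {q : ι → ℝ}
    (hq : ∑ a, q a = 1) :
    ∑ a, q a * v a - α * ∑ a, q a ^ 2 ≤ (∑ a, v a - α) / Fintype.card ι +
      (∑ a, ∑ b, (v a - v b) ^ 2) / (8 * α * Fintype.card ι) := by
  set c := (∑ a, v a - 2 * α) / Fintype.card ι with hc
  have hsq : 0 ≤ ∑ a, (2 * α * q a - v a + c) ^ 2 := sum_nonneg fun a _ ↦ sq_nonneg _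
  have hterm (a : ι) : (2 * α * q a - v a + c) ^ 2 =
      4 * α ^ 2 * q a ^ 2 - 4 * α * (q a * v a) + v a ^ 2 +
        4 * α * c * q a - 2 * c * v a + c ^ 2 := by
    ring
  simp only [hterm, sum_sub_distrib, sum_add_distrib, ← mul_sum, hq, sum_const, card_univ,
    nsmul_eq_mul] at hsq
  have hgap : (∑ a, v a - α) / Fintype.card ι +
      (∑ a, ∑ b, (v a - v b) ^ 2) / (8 * α * Fintype.card ι) -
        (∑ a, q a * v a - α * ∑ a, q a ^ 2) =
      (4 * α ^ 2 * ∑ a, q a ^ 2 - 4 * α * ∑ a, q a * v a + ∑ a, v a ^ 2 + 4 * α * c * 1 -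
        2 * c * ∑ a, v a + Fintype.card ι * c ^ 2) / (4 * α) := by
    rw [sum_sum_sub_sq, hc]
    field_simp
    ring
  rw [← sub_nonneg, hgap]
  exact div_nonneg hsq (by positivity)

variable [DecidableEq ι]

theorem hashForm_add_le {m : ℕ} {α : ℝ} (hα : 0 < α) (hcard : Fintype.card ι = m + 3)
    {p q : ι → ℝ} (hp : ∑ a, p a = 1) (hq : ∑ a, q a = 1) :
    hashForm (m + 1) p q + α * (∑ a, q a * p a - ∑ a, q a ^ 2) ≤
      2 * (m + 1).factorial / (m + 3) * esymmOn univ p (m + 1) +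
      (∑ a, ∑ b, (p a - p b) ^ 2 *
        (α - (m + 1).factorial * esymmOn ((univ.erase a).erase b) p m) ^ 2) /
          (8 * α * (m + 3)) := by
  have : Nonempty ι := Fintype.card_pos_iff.1 (by omega)
  let v (a : ι) : ℝ := (m + 1).factorial * esymmOn (univ.erase a) p (m + 1) + α * p a
  have hvsum : ∑ a, v a = 2 * (m + 1).factorial * esymmOn univ p (m + 1) + α := by
    simp only [v, sum_add_distrib, ← mul_sum, sum_esymmOn_erase, hp, card_univ, hcard]
    push_cast
    ring
  have hvsub (a b : ι) : (v a - v b) ^ 2 = (p a - p b) ^ 2 *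
      (α - (m + 1).factorial * esymmOn ((univ.erase a).erase b) p m) ^ 2 := by
    rcases eq_or_ne a b with rfl | hab
    · ring
    · have h := sub_mul_esymmOn_erase_erase p m (mem_univ a) (mem_univ b) hab
      rw [← mul_pow]
      congr 1
      linear_combination ((m + 1).factorial : ℝ) * h
  have hqv : ∑ a, q a * v a = hashForm (m + 1) p q + α * ∑ a, q a * p a := by
    rw [hashForm, mul_sum, mul_sum, ← sum_add_distrib]
    exact sum_congr rfl fun a _ ↦ by ring
  have h := sum_mul_sub_mul_sum_sq_le hα v hq
  simp only [hvsub, hvsum, hqv, hcard] at h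
  push_cast at h
  refine (le_of_eq ?_).trans (h.trans_eq ?_) <;> ring

theorem hashForm_nonneg {m : ℕ} {p q : ι → ℝ} (hp : ∀ a, 0 ≤ p a) (hq : ∀ a, 0 ≤ q a) :
    0 ≤ hashForm m p q :=
  mul_nonneg (Nat.cast_nonneg _) <| sum_nonneg fun a _ ↦
    mul_nonneg (hq a) (esymmOn_nonneg (fun b _ ↦ hp b) m)

/-- The bound `M` on `hashForm`, relaxed by a Lagrange multiplier term: that term is linear in `p`,
so it disappears when `p` is averaged over distributions whose mean is `q`. -/
def IsHashFormBound (ι : Type*) [Fintype ι] [DecidableEq ι] (m : ℕ) (α M : ℝ) : Prop :=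
  ∀ p ∈ stdSimplex ℝ ι, ∀ q ∈ stdSimplex ℝ ι,
    hashForm m p q ≤ M + α * ∑ a, (q a - p a) * q a

theorem IsHashFormBound.nonneg [Nonempty ι] {m : ℕ} {α M : ℝ} (h : IsHashFormBound ι m α M) :
    0 ≤ M := by
  obtain ⟨a⟩ := ‹Nonempty ι›
  have hmem := single_mem_stdSimplex ℝ a
  simpa using (hashForm_nonneg hmem.1 hmem.1).trans (h _ hmem _ hmem)

theorem IsHashFormBound.sum_mul_hashForm_le {m : ℕ} {α M : ℝ} (h : IsHashFormBound ι m α M)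
    {β : Type*} {s : Finset β} {w : β → ℝ} (hw : ∀ t ∈ s, 0 ≤ w t) {p : β → ι → ℝ}
    (hp : ∀ t ∈ s, w t ≠ 0 → p t ∈ stdSimplex ℝ ι) {q : ι → ℝ} (hq : q ∈ stdSimplex ℝ ι)
    (hmean : ∀ a, ∑ t ∈ s, w t * p t a = (∑ t ∈ s, w t) * q a) :
    ∑ t ∈ s, w t * hashForm m (p t) q ≤ M * ∑ t ∈ s, w t := by
  have hterm : ∀ t ∈ s, w t * hashForm m (p t) q ≤
      w t * (M + α * ∑ a, (q a - p t a) * q a) := by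
    intro t ht
    rcases eq_or_ne (w t) 0 with h0 | h0
    · simp [h0]
    · exact mul_le_mul_of_nonneg_left (h _ (hp t ht h0) _ hq) (hw t ht)
  have hmultiplier : ∑ t ∈ s, w t * ∑ a, (q a - p t a) * q a = 0 := by
    simp only [mul_sum]
    rw [sum_comm]
    refine sum_eq_zero fun a _ ↦ ?_
    simp only [← mul_assoc, mul_sub, ← sum_mul, sum_sub_distrib, hmean, sub_self, zero_mul]
  calc ∑ t ∈ s, w t * hashForm m (p t) q
      ≤ ∑ t ∈ s, w t * (M + α * ∑ a, (q a - p t a) * q a) := sum_le_sum hterm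
    _ = M * ∑ t ∈ s, w t + α * ∑ t ∈ s, w t * ∑ a, (q a - p t a) * q a := by
      rw [mul_sum, mul_sum, ← sum_add_distrib]
      exact sum_congr rfl fun t _ ↦ by ring
    _ = M * ∑ t ∈ s, w t := by rw [hmultiplier, mul_zero, add_zero]

theorem isHashFormBound_of_weight_le {m : ℕ} {α M : ℝ} (hα : 0 < α)
    (hcard : Fintype.card ι = m + 3) (w : (ι → ℝ) → ι → ι → ℝ)
    (hw : ∀ p ∈ stdSimplex ℝ ι, ∀ a b, a ≠ b →
      (α - (m + 1).factorial * esymmOn ((univ.erase a).erase b) p m) ^ 2 ≤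
        8 * α * (m + 3) * w p a b)
    (hM : ∀ p ∈ stdSimplex ℝ ι, 2 * (m + 1).factorial / (m + 3) * esymmOn univ p (m + 1) +
      ∑ a, ∑ b, (p a - p b) ^ 2 * w p a b ≤ M) :
    IsHashFormBound ι (m + 1) α M := by
  intro p hp q hq
  have hsum : (∑ a, ∑ b, (p a - p b) ^ 2 *
      (α - (m + 1).factorial * esymmOn ((univ.erase a).erase b) p m) ^ 2) / (8 * α * (m + 3)) ≤
      ∑ a, ∑ b, (p a - p b) ^ 2 * w p a b := by
    rw [div_le_iff₀' (by positivity), mul_sum]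
    refine sum_le_sum fun a _ ↦ ?_
    rw [mul_sum]
    refine sum_le_sum fun b _ ↦ ?_
    rcases eq_or_ne a b with rfl | hab
    · simp
    · rw [mul_left_comm]
      exact mul_le_mul_of_nonneg_left (hw p hp a b hab) (sq_nonneg _)
  have hlinear : ∑ a, (q a - p a) * q a = -(∑ a, q a * p a - ∑ a, q a ^ 2) := by
    rw [neg_sub, ← sum_sub_distrib]
    exact sum_congr rfl fun a _ ↦ by ring
  rw [hlinear]
  linarith [hashForm_add_le hα hcard hp.2 hq.2, hM p hp]

/-- `24 / 125` is the value of `hashForm` at the uniform distribution. The weights are affine in the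
elementary symmetric polynomials of the symbols other than `a` and `b`, with coefficients that make
all the terms `esymmOn univ p j`, `j ≥ 2`, cancel. -/
theorem isHashFormBound_three (hcard : Fintype.card ι = 5) :
    IsHashFormBound ι 3 (24 / 25) (24 / 125) := by
  refine isHashFormBound_of_weight_le (m := 2) (by norm_num) hcard
    (fun p a b ↦ 3 / 125 + 2 / 25 * esymmOn ((univ.erase a).erase b) p 1) ?_ ?_
  · intro p hp a b hab
    have h := sq_sub_esymmOn_two_le (s := (univ.erase a).erase b) (p := p)
      (by simp [card_erase_of_mem, hab.symm, hcard]) (fun c _ ↦ hp.1 c)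
      ((sum_le_univ_sum_of_nonneg hp.1).trans_eq hp.2)
    norm_num [Nat.factorial] at h ⊢
    linarith
  · intro p hp
    have h₀ := sum_sum_sq_sub_mul_esymmOn_erase_erase univ p 0
    have h₁ := sum_sum_sq_sub_mul_esymmOn_erase_erase univ p 1
    simp only [card_univ, hcard, hp.2, esymmOn_zero] at h₀ h₁
    simp only [mul_add, sum_add_distrib, mul_left_comm _ (2 / 25 : ℝ), ← mul_sum, ← sum_mul]
    norm_num [Nat.factorial, hp.2] at h₀ h₁ ⊢
    linarith

/-- `5 / 54` is the value of `hashForm` at the uniform distribution. -/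
theorem isHashFormBound_four (hcard : Fintype.card ι = 6) :
    IsHashFormBound ι 4 (4 / 9) (5 / 54) := by
  refine isHashFormBound_of_weight_le (m := 3) (by norm_num) hcard
    (fun p a b ↦ 1 / 108 + 1 / 36 * esymmOn ((univ.erase a).erase b) p 1 +
      1 / 6 * esymmOn ((univ.erase a).erase b) p 2) ?_ ?_
  · intro p hp a b hab
    have h := sq_sub_esymmOn_three_le (s := (univ.erase a).erase b) (p := p)
      (by simp [card_erase_of_mem, hab.symm, hcard]) (fun c _ ↦ hp.1 c)
      ((sum_le_univ_sum_of_nonneg hp.1).trans_eq hp.2)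
    norm_num [Nat.factorial] at h ⊢
    linarith
  · intro p hp
    have h₀ := sum_sum_sq_sub_mul_esymmOn_erase_erase univ p 0
    have h₁ := sum_sum_sq_sub_mul_esymmOn_erase_erase univ p 1
    have h₂ := sum_sum_sq_sub_mul_esymmOn_erase_erase univ p 2
    simp only [card_univ, hcard, hp.2, esymmOn_zero] at h₀ h₁ h₂
    simp only [mul_add, sum_add_distrib, mul_left_comm _ (1 / 36 : ℝ),
      mul_left_comm _ (1 / 6 : ℝ), ← mul_sum, ← sum_mul]
    norm_num [Nat.factorial, hp.2] at h₀ h₁ h₂ ⊢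
    linarith

end HashForm

section SymbolFrequencies

variable {κ ι : Type*} [DecidableEq ι]

/-- The proportion of the words of `B` whose symbol at coordinate `i` is `a`, with value `0` if `B`
is empty. -/
noncomputable def symbolFreq (B : Finset (κ → ι)) (i : κ) (a : ι) : ℝ :=
  #{w ∈ B | w i = a} / #B

theorem card_mul_symbolFreq (B : Finset (κ → ι)) (i : κ) (a : ι) :
    #B * symbolFreq B i a = #{w ∈ B | w i = a} := by
  rcases B.eq_empty_or_nonempty with rfl | hB
  · simp
  · exact mul_div_cancel₀ _ (by exact_mod_cast hB.card_ne_zero)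

theorem symbolFreq_eq_zero {B : Finset (κ → ι)} {i : κ} {a : ι} (ha : a ∉ B.image (· i)) :
    symbolFreq B i a = 0 := by
  have hempty : {w ∈ B | w i = a} = ∅ :=
    filter_eq_empty_iff.2 fun w hw h ↦ ha (mem_image.2 ⟨w, hw, h⟩)
  simp [symbolFreq, hempty]

variable [Fintype ι]

theorem sum_comp_eq_card_mul_sum_symbolFreq_mul (C : Finset (κ → ι)) (i : κ) (F : ι → ℝ) :
    ∑ y ∈ C, F (y i) = #C * ∑ a, symbolFreq C i a * F a := by
  rw [← sum_fiberwise C (fun y ↦ y i), mul_sum]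
  refine sum_congr rfl fun a _ ↦ ?_
  rw [← mul_assoc, card_mul_symbolFreq, ← nsmul_eq_mul, ← sum_const]
  exact sum_congr rfl fun y hy ↦ by rw [(mem_filter.1 hy).2]

theorem symbolFreq_mem_stdSimplex {B : Finset (κ → ι)} (hB : B.Nonempty) (i : κ) :
    symbolFreq B i ∈ stdSimplex ℝ ι := by
  refine ⟨fun a ↦ by unfold symbolFreq; positivity, ?_⟩
  have hpos : (#B : ℝ) ≠ 0 := by exact_mod_cast hB.card_ne_zero
  simpa [hpos] using (sum_comp_eq_card_mul_sum_symbolFreq_mul B i 1).symm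

theorem hashForm_symbolFreq_eq_zero {m : ℕ} {B : Finset (κ → ι)} {i : κ}
    (hB : #(B.image (· i)) < m) (q : ι → ℝ) : hashForm m (symbolFreq B i) q = 0 := by
  have hesymm (s : Finset ι) : esymmOn s (symbolFreq B i) m = 0 := by
    rw [esymmOn_eq_sum_prod]
    refine sum_eq_zero fun T hT ↦ ?_
    obtain ⟨a, haT, ha⟩ := exists_mem_notMem_of_card_lt_card
      (hB.trans_eq (mem_powersetCard.1 hT).2.symm)
    exact prod_eq_zero haT (symbolFreq_eq_zero ha)
  simp [hashForm, hesymm]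

theorem card_filter_piFinset_injective_ne (m : ℕ) (B : Finset (κ → ι)) (i : κ) (a : ι) :
    (#{x ∈ Fintype.piFinset fun _ : Fin m ↦ B | (fun j ↦ x j i).Injective ∧ ∀ j, x j i ≠ a} : ℝ) =
      (#B : ℝ) ^ m * (m.factorial * esymmOn (univ.erase a) (symbolFreq B i) m) := by
  classical
  have hfiber (f : Fin m → ι) :
      (#{x ∈ Fintype.piFinset fun _ : Fin m ↦ B | (fun j ↦ x j i) = f} : ℝ) =
        (#B : ℝ) ^ m * ∏ j, symbolFreq B i (f j) := by
    have hpi : {x ∈ Fintype.piFinset fun _ : Fin m ↦ B | (fun j ↦ x j i) = f} =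
        Fintype.piFinset fun j ↦ {w ∈ B | w i = f j} := by
      ext x
      simp [Fintype.mem_piFinset, funext_iff, forall_and]
    rw [hpi, Fintype.card_piFinset, Nat.cast_prod]
    simp only [← card_mul_symbolFreq, prod_mul_distrib, prod_const, card_univ, Fintype.card_fin]
  rw [← sum_injective_prod_eq_factorial_mul_esymmOn, mul_sum]
  simp only [← hfiber, mem_erase, mem_univ, and_true]
  rw [card_eq_sum_card_fiberwise (f := fun x j ↦ x j i)
    (t := {f : Fin m → ι | f.Injective ∧ ∀ j, f j ≠ a})
    fun x hx ↦ by simpa using (mem_filter.1 hx).2]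
  push_cast
  refine sum_congr rfl fun f hf ↦ ?_
  rw [filter_filter]
  congr 2
  ext x
  simp only [mem_filter, mem_univ, true_and] at hf ⊢
  constructor
  · exact fun h ↦ ⟨h.1, h.2.2⟩
  · rintro ⟨hx, rfl⟩
    exact ⟨hx, hf, rfl⟩

theorem sum_card_filter_injective_ne (m : ℕ) (B C : Finset (κ → ι)) (i : κ) :
    ∑ x ∈ Fintype.piFinset fun _ : Fin m ↦ B,
      (#{y ∈ C | (fun j ↦ x j i).Injective ∧ ∀ j, x j i ≠ y i} : ℝ) =
    (#B : ℝ) ^ m * #C * hashForm m (symbolFreq B i) (symbolFreq C i) := by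
  classical
  calc ∑ x ∈ Fintype.piFinset fun _ : Fin m ↦ B,
        (#{y ∈ C | (fun j ↦ x j i).Injective ∧ ∀ j, x j i ≠ y i} : ℝ)
      = ∑ y ∈ C, (#{x ∈ Fintype.piFinset fun _ : Fin m ↦ B |
          (fun j ↦ x j i).Injective ∧ ∀ j, x j i ≠ y i} : ℝ) := by
        exact_mod_cast sum_card_bipartiteAbove_eq_sum_card_bipartiteBelow _
    _ = ∑ y ∈ C, (#B : ℝ) ^ m * (m.factorial * esymmOn (univ.erase (y i)) (symbolFreq B i) m) := by
        simp only [card_filter_piFinset_injective_ne]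
    _ = _ := by
        rw [sum_comp_eq_card_mul_sum_symbolFreq_mul C i fun a ↦
          (#B : ℝ) ^ m * (m.factorial * esymmOn (univ.erase a) (symbolFreq B i) m), hashForm]
        simp only [mul_sum]
        exact sum_congr rfl fun a _ ↦ by ring

end SymbolFrequencies

section Tuples

theorem pow_mul_sub_sq_le_mul_descFactorial (b m : ℕ) :
    (b : ℝ) ^ m * (b - (m : ℝ) ^ 2) ≤ b * (b.descFactorial m : ℝ) := by
  rcases b.eq_zero_or_pos with rfl | hb
  · simpa using by positivity
  have hb' : (0 : ℝ) < b := by exact_mod_cast hb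
  rcases lt_or_ge b m with hbm | hbm
  · have hm : (b : ℝ) + 1 ≤ m := by exact_mod_cast hbm
    exact (mul_nonpos_of_nonneg_of_nonpos (by positivity) (by nlinarith)).trans (by positivity)
  have hm : (m : ℝ) ≤ b := by exact_mod_cast hbm
  have hbernoulli := one_add_mul_le_pow (a := -((m - 1) / b : ℝ))
    (by rw [neg_le_neg_iff, div_le_iff₀ hb']; linarith) m
  have hdesc : ((b : ℝ) + 1 - m) ^ m ≤ b.descFactorial m := by
    have h := Nat.pow_sub_le_descFactorial b m
    rw [← Nat.cast_le (α := ℝ)] at h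
    push_cast [Nat.cast_sub (hbm.trans b.le_succ)] at h
    exact h
  calc (b : ℝ) ^ m * (b - (m : ℝ) ^ 2)
      ≤ b ^ m * (b - m * (m - 1)) := by gcongr; nlinarith [(Nat.cast_nonneg m : (0 : ℝ) ≤ m)]
    _ = b * (b ^ m * (1 + m * -((m - 1) / b))) := by field_simp; ring
    _ ≤ b * (b ^ m * (1 + -((m - 1) / b)) ^ m) := by gcongr
    _ = b * (b + 1 - m) ^ m := by rw [← mul_pow]; congr 2; field_simp; ring
    _ ≤ b * b.descFactorial m := by gcongr

theorem card_filter_piFinset_injective {α : Type*} [DecidableEq α] (m : ℕ) (B : Finset α) :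
    #{x ∈ Fintype.piFinset fun _ : Fin m ↦ B | x.Injective} = (#B).descFactorial m := by
  have hcard : #(univ : Finset (Fin m ↪ B)) = (#B).descFactorial m := by simp
  rw [← hcard]
  refine (card_bij (fun e _ j ↦ (e j : α)) (fun e _ ↦ ?_) (fun e _ e' _ h ↦ ?_) fun x hx ↦ ?_).symm
  · simp only [mem_filter, Fintype.mem_piFinset]
    exact ⟨fun j ↦ (e j).2, Subtype.val_injective.comp e.injective⟩
  · ext j
    exact congrFun h j
  · simp only [mem_filter, Fintype.mem_piFinset] at hx
    exact ⟨⟨fun j ↦ ⟨x j, hx.1 j⟩, fun j j' h ↦ hx.2 (congrArg Subtype.val h)⟩, mem_univ _, rfl⟩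

end Tuples

section Subcodes

variable {m n : ℕ} {C : Finset (Fin n → Fin (m + 2))}

theorem IsPerfectHash.card_sub_sq_mul_le (hC : IsPerfectHash (m + 2) n C) (hm : m < #C)
    {B : Finset (Fin n → Fin (m + 2))} (hB : B ⊆ C) :
    (#B - (m : ℝ) ^ 2) * ((#C - m) * Real.logb 2 (#C - m)) ≤
      ∑ i, #B * #C * hashForm m (symbolFreq B i) (symbolFreq C i) := by
  set K : ℝ := (#C - m) * Real.logb 2 (#C - m)
  have hK : 0 ≤ K := by
    have h : (1 : ℝ) ≤ #C - m := by rw [le_sub_iff_add_le']; exact_mod_cast hm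
    exact mul_nonneg (by linarith) (Real.logb_nonneg one_lt_two h)
  rcases B.eq_empty_or_nonempty with rfl | hBne
  · simpa using by positivity
  have hBpos : (0 : ℝ) < #B := by exact_mod_cast hBne.card_pos
  have hsum : ((#B).descFactorial m : ℝ) * K ≤
      ∑ i, (#B : ℝ) ^ m * #C * hashForm m (symbolFreq B i) (symbolFreq C i) := calc
    _ = ∑ x ∈ Fintype.piFinset fun _ : Fin m ↦ B with x.Injective, K := by
      rw [sum_const, card_filter_piFinset_injective, nsmul_eq_mul]
    _ ≤ ∑ x ∈ Fintype.piFinset fun _ : Fin m ↦ B with x.Injective,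
        ∑ i, (#{y ∈ C | (fun j ↦ x j i).Injective ∧ ∀ j, x j i ≠ y i} : ℝ) := by
      refine sum_le_sum fun x hx ↦ ?_
      rw [mem_filter, Fintype.mem_piFinset] at hx
      exact hC.card_sub_mul_logb_le hx.2 fun j ↦ hB (hx.1 j)
    _ ≤ ∑ x ∈ Fintype.piFinset fun _ : Fin m ↦ B,
        ∑ i, (#{y ∈ C | (fun j ↦ x j i).Injective ∧ ∀ j, x j i ≠ y i} : ℝ) :=
      sum_le_sum_of_subset_of_nonneg (filter_subset _ _) fun _ _ _ ↦ by positivity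
    _ = _ := by
      rw [sum_comm]
      exact sum_congr rfl fun i _ ↦ sum_card_filter_injective_ne m B C i
  refine le_of_mul_le_mul_left ?_ (pow_pos hBpos m)
  calc (#B : ℝ) ^ m * ((#B - (m : ℝ) ^ 2) * K)
      = (#B : ℝ) ^ m * (#B - (m : ℝ) ^ 2) * K := by ring
    _ ≤ #B * ((#B).descFactorial m : ℝ) * K := by
      exact mul_le_mul_of_nonneg_right (pow_mul_sub_sq_le_mul_descFactorial _ _) hK
    _ ≤ #B * ∑ i, (#B : ℝ) ^ m * #C * hashForm m (symbolFreq B i) (symbolFreq C i) := by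
      rw [mul_assoc]; gcongr
    _ = _ := by simp only [mul_sum]; exact sum_congr rfl fun i _ ↦ by ring

end Subcodes

section Boxes

variable {κ ι : Type*} [Fintype κ] [DecidableEq κ] [Fintype ι] {𝒮 : Finset (Finset ι)}
  {J : Finset κ}

/-- The boxes, encoded by their sides, whose sides lie in `𝒮` at the coordinates in `J` and are
unrestricted at the others. -/
def boxes (𝒮 : Finset (Finset ι)) (J : Finset κ) : Finset (κ → Finset ι) :=
  Fintype.piFinset fun i ↦ if i ∈ J then 𝒮 else {univ}

theorem mem_of_mem_boxes {b : κ → Finset ι} (hb : b ∈ boxes 𝒮 J) {i : κ} (hi : i ∈ J) :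
    b i ∈ 𝒮 := by
  simpa [hi] using Fintype.mem_piFinset.1 hb i

variable (𝒮 J) in
theorem card_boxes : #(boxes 𝒮 J) = #𝒮 ^ #J := by
  rw [boxes, Fintype.card_piFinset]
  simp only [apply_ite card, card_singleton, prod_ite_mem, univ_inter, prod_const]

variable [DecidableEq ι] {D : ℕ}

theorem card_filter_boxes_mem_piFinset (hD : ∀ a, #{S ∈ 𝒮 | a ∈ S} = D) (w : κ → ι) :
    #{b ∈ boxes 𝒮 J | w ∈ Fintype.piFinset b} = D ^ #J := by
  have hpi : {b ∈ boxes 𝒮 J | w ∈ Fintype.piFinset b} =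
      Fintype.piFinset fun i ↦ {S ∈ if i ∈ J then 𝒮 else {univ} | w i ∈ S} := by
    ext b
    simp [boxes, Fintype.mem_piFinset, forall_and]
  have hside (i : κ) :
      #{S ∈ if i ∈ J then 𝒮 else {univ} | w i ∈ S} = if i ∈ J then D else 1 := by
    split_ifs
    · exact hD (w i)
    · simp [filter_singleton]
  simp only [hpi, Fintype.card_piFinset, hside, prod_ite_mem, univ_inter, prod_const]

theorem sum_card_inter_piFinset (hD : ∀ a, #{S ∈ 𝒮 | a ∈ S} = D) (A : Finset (κ → ι)) :
    ∑ b ∈ boxes 𝒮 J, #(A ∩ Fintype.piFinset b) = D ^ #J * #A := by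
  calc ∑ b ∈ boxes 𝒮 J, #(A ∩ Fintype.piFinset b)
      = ∑ b ∈ boxes 𝒮 J, #{w ∈ A | w ∈ Fintype.piFinset b} := by simp only [filter_mem_eq_inter]
    _ = ∑ w ∈ A, #{b ∈ boxes 𝒮 J | w ∈ Fintype.piFinset b} :=
      sum_card_bipartiteAbove_eq_sum_card_bipartiteBelow _
    _ = D ^ #J * #A := by
      simp only [card_filter_boxes_mem_piFinset hD, sum_const, smul_eq_mul, mul_comm]

theorem IsHashFormBound.sum_boxes_mul_hashForm_le {m : ℕ} {α M : ℝ} (h : IsHashFormBound ι m α M)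
    (hD : ∀ a, #{S ∈ 𝒮 | a ∈ S} = D) {C : Finset (κ → ι)} (hC : C.Nonempty) (i : κ) :
    ∑ b ∈ boxes 𝒮 J, #(C ∩ Fintype.piFinset b) *
      hashForm m (symbolFreq (C ∩ Fintype.piFinset b) i) (symbolFreq C i) ≤
        M * (D ^ #J * #C) := by
  have htotal (A : Finset (κ → ι)) :
      ∑ b ∈ boxes 𝒮 J, (#(A ∩ Fintype.piFinset b) : ℝ) = D ^ #J * #A := by
    exact_mod_cast sum_card_inter_piFinset hD A
  rw [← htotal]
  refine h.sum_mul_hashForm_le (fun _ _ ↦ Nat.cast_nonneg _)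
    (fun b _ hb ↦ symbolFreq_mem_stdSimplex (card_ne_zero.1 (by exact_mod_cast hb)) i)
    (symbolFreq_mem_stdSimplex hC i) fun a ↦ ?_
  rw [htotal, mul_assoc, card_mul_symbolFreq]
  simp only [card_mul_symbolFreq, ← filter_inter, htotal]

end Boxes

theorem IsPerfectHash.pow_mul_card_sub_mul_le {m n D : ℕ} {α M : ℝ}
    {C : Finset (Fin n → Fin (m + 2))} (hC : IsPerfectHash (m + 2) n C) (hm : m < #C)
    (J : Finset (Fin n)) {𝒮 : Finset (Finset (Fin (m + 2)))} (h𝒮 : ∀ S ∈ 𝒮, #S < m)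
    (hD : ∀ a, #{S ∈ 𝒮 | a ∈ S} = D) (hM : IsHashFormBound (Fin (m + 2)) m α M) :
    ((D : ℝ) ^ #J * #C - #𝒮 ^ #J * (m : ℝ) ^ 2) * ((#C - m) * Real.logb 2 (#C - m)) ≤
      (n - #J) * (M * (D ^ #J * #C) * #C) := by
  set K : ℝ := (#C - m) * Real.logb 2 (#C - m)
  let sub (b : Fin n → Finset (Fin (m + 2))) : Finset (Fin n → Fin (m + 2)) :=
    C ∩ Fintype.piFinset b
  let f (b : Fin n → Finset (Fin (m + 2))) (i : Fin n) : ℝ :=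
    hashForm m (symbolFreq (sub b) i) (symbolFreq C i)
  have hrestricted : ∀ i ∈ J, ∀ b ∈ boxes 𝒮 J, f b i = 0 := by
    intro i hi b hb
    refine hashForm_symbolFreq_eq_zero ((card_le_card ?_).trans_lt
      (h𝒮 _ (mem_of_mem_boxes hb hi))) _
    exact image_subset_iff.2 fun w hw ↦ Fintype.mem_piFinset.1 (mem_inter.1 hw).2 i
  have hcoordinate (i : Fin n) :
      ∑ b ∈ boxes 𝒮 J, #(sub b) * f b i ≤ if i ∈ J then 0 else M * (D ^ #J * #C) := by
    split_ifs with hi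
    · exact (sum_eq_zero fun b hb ↦ by rw [hrestricted i hi b hb, mul_zero]).le
    · exact hM.sum_boxes_mul_hashForm_le hD (card_pos.1 (by omega)) i
  calc ((D : ℝ) ^ #J * #C - #𝒮 ^ #J * (m : ℝ) ^ 2) * K
      = ∑ b ∈ boxes 𝒮 J, (#(sub b) - (m : ℝ) ^ 2) * K := by
        rw [← sum_mul, sum_sub_distrib, sum_const, card_boxes, nsmul_eq_mul, ← Nat.cast_sum,
          sum_card_inter_piFinset hD]
        push_cast
        rfl
    _ ≤ ∑ b ∈ boxes 𝒮 J, ∑ i, #(sub b) * #C * f b i :=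
        sum_le_sum fun b _ ↦ hC.card_sub_sq_mul_le hm inter_subset_left
    _ = ∑ i, (∑ b ∈ boxes 𝒮 J, #(sub b) * f b i) * #C := by
        rw [sum_comm]
        simp only [sum_mul, mul_right_comm]
    _ ≤ ∑ i, (if i ∈ J then 0 else M * (D ^ #J * #C)) * #C := by
        gcongr with i
        exact hcoordinate i
    _ = (n - #J) * (M * (D ^ #J * #C) * #C) := by
        simp only [ite_mul, zero_mul, ← ite_not (p := _ ∈ J), ← mem_compl, sum_ite_mem, univ_inter,
          sum_const, card_compl, Fintype.card_fin, nsmul_eq_mul]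
        rw [Nat.cast_sub (by simpa using card_le_univ J)]

section Asymptotics

open Filter Topology

theorem pow_floor_le_two_rpow {K θ : ℝ} (hK : 1 ≤ K) (hθ : 0 ≤ θ) (n : ℕ) :
    K ^ ⌊θ * n⌋₊ ≤ (2 : ℝ) ^ (θ * Real.logb 2 K * n) := calc
  K ^ ⌊θ * n⌋₊ = K ^ (⌊θ * n⌋₊ : ℝ) := (Real.rpow_natCast _ _).symm
  _ ≤ K ^ (θ * n) := Real.rpow_le_rpow_of_exponent_le hK (Nat.floor_le (by positivity))
  _ = ((2 : ℝ) ^ Real.logb 2 K) ^ (θ * n) := by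
    rw [Real.rpow_logb two_pos one_lt_two.ne' (by linarith)]
  _ = (2 : ℝ) ^ (θ * Real.logb 2 K * n) := by
    rw [← Real.rpow_mul two_pos.le]
    ring_nf

theorem IsPerfectHash.card_sub_two_rpow_mul_le {m n D : ℕ} {α M θ : ℝ}
    {C : Finset (Fin n → Fin (m + 2))} (hC : IsPerfectHash (m + 2) n C) (hm : m < #C)
    {𝒮 : Finset (Finset (Fin (m + 2)))} (h𝒮 : ∀ S ∈ 𝒮, #S < m) (hD₀ : 0 < D)
    (hD : ∀ a, #{S ∈ 𝒮 | a ∈ S} = D) (hM : IsHashFormBound (Fin (m + 2)) m α M)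
    (hθ : θ ∈ Set.Icc 0 1) :
    (#C - 2 ^ (θ * Real.logb 2 (#𝒮 / D) * n) * (m : ℝ) ^ 2) *
      ((#C - m) * Real.logb 2 (#C - m)) ≤ ((1 - θ) * n + 1) * (M * #C * #C) := by
  have hDpos : (0 : ℝ) < D := by exact_mod_cast hD₀
  have hratio : 1 ≤ (#𝒮 : ℝ) / D := by
    rw [one_le_div hDpos, ← hD 0]
    exact_mod_cast card_filter_le _ _
  have hM₀ := hM.nonneg
  have hlog : 0 ≤ ((#C : ℝ) - m) * Real.logb 2 (#C - m) := by
    have h : (1 : ℝ) ≤ #C - m := by rw [le_sub_iff_add_le']; exact_mod_cast hm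
    exact mul_nonneg (by linarith) (Real.logb_nonneg one_lt_two h)
  have hfloor : ⌊θ * n⌋₊ ≤ n :=
    Nat.floor_le_of_le (mul_le_of_le_one_left n.cast_nonneg hθ.2)
  obtain ⟨J, -, hJ⟩ := exists_subset_card_eq (s := (univ : Finset (Fin n))) (by simpa using hfloor)
  have hbound := hC.pow_mul_card_sub_mul_le hm J h𝒮 hD hM
  have hcancel : (#C - (#𝒮 / D : ℝ) ^ #J * (m : ℝ) ^ 2) * ((#C - m) * Real.logb 2 (#C - m)) ≤
      (n - #J) * (M * #C * #C) := by
    have hpow : (#𝒮 : ℝ) ^ #J = D ^ #J * (#𝒮 / D : ℝ) ^ #J := by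
      rw [← mul_pow, mul_div_cancel₀ _ hDpos.ne']
    rw [hpow] at hbound
    refine le_of_mul_le_mul_left ?_ (pow_pos hDpos #J)
    linarith
  calc _ ≤ (#C - (#𝒮 / D : ℝ) ^ #J * (m : ℝ) ^ 2) * ((#C - m) * Real.logb 2 (#C - m)) := by
        gcongr
        rw [hJ]
        exact pow_floor_le_two_rpow hratio hθ.1 n
    _ ≤ (n - #J) * (M * #C * #C) := hcancel
    _ ≤ _ := by
        gcongr
        rw [hJ]
        linarith [Nat.lt_floor_add_one (θ * n)]

theorem tendsto_const_mul_two_rpow_pow {t : ℝ} (ht : t < 0) (a : ℝ) :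
    Tendsto (fun n : ℕ ↦ a * ((2 : ℝ) ^ t) ^ n) atTop (𝓝 0) := by
  simpa using (tendsto_pow_atTop_nhds_zero_of_lt_one (by positivity)
    (Real.rpow_lt_one_of_one_lt_of_neg one_lt_two ht)).const_mul a

theorem eventually_mul_lt_one_sub_mul_mul {c M r s : ℝ} (a b : ℝ) (hr : 0 < r) (hs : s < r)
    (hc : c * M < r) :
    ∀ᶠ n : ℕ in atTop, (c * n + 1) * M <
      (1 - a * ((2 : ℝ) ^ (s - r)) ^ n) * ((1 - b * ((2 : ℝ) ^ (-r)) ^ n) * (r * n - 1)) := by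
  have hpow {t : ℝ} (ht : t < 0) (a : ℝ) :
      Tendsto (fun n : ℕ ↦ 1 - a * ((2 : ℝ) ^ t) ^ n) atTop (𝓝 1) := by
    simpa using (tendsto_const_mul_two_rpow_pow ht a).const_sub 1
  have hinv : Tendsto (fun n : ℕ ↦ (n : ℝ)⁻¹) atTop (𝓝 0) := tendsto_inv_atTop_nhds_zero_nat
  have hleft : Tendsto (fun n : ℕ ↦ (c + (n : ℝ)⁻¹) * M) atTop (𝓝 (c * M)) := by
    simpa using (hinv.const_add c).mul_const M
  have hright : Tendsto (fun n : ℕ ↦ (1 - a * ((2 : ℝ) ^ (s - r)) ^ n) *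
      ((1 - b * ((2 : ℝ) ^ (-r)) ^ n) * (r - (n : ℝ)⁻¹))) atTop (𝓝 r) := by
    simpa using (hpow (sub_neg.2 hs) a).mul
      ((hpow (neg_lt_zero.2 hr) b).mul (hinv.const_sub r))
  filter_upwards [hleft.eventually_lt hright hc, eventually_gt_atTop 0] with n hn hn₀
  have hn₀' : (0 : ℝ) < n := by exact_mod_cast hn₀
  have h := mul_lt_mul_of_pos_left hn hn₀'
  have hl : (n : ℝ) * ((c + (n : ℝ)⁻¹) * M) = (c * n + 1) * M := by field_simp
  have hr' : (n : ℝ) * (r - (n : ℝ)⁻¹) = r * n - 1 := by field_simp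
  rw [hl, mul_left_comm, mul_left_comm (n : ℝ), hr'] at h
  exact h

theorem one_sub_mul_one_sub_mul_mul_sq_le {a b x N ρ : ℝ} (ha : 0 ≤ a) (hb : 0 ≤ b) (hx : 0 ≤ x)
    (hax : a * x ≤ 1) (hbρ : 2 * (b + 1) ≤ 2 ^ ρ) (hN : 2 ^ ρ ≤ N) :
    (1 - a * x) * ((1 - b * 2 ^ (-ρ)) * (ρ - 1)) * N ^ 2 ≤
      (N - x * 2 ^ ρ * a) * ((N - b) * Real.logb 2 (N - b)) := by
  have hN₀ : 0 < N := by linarith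
  have hinv : (2 : ℝ) ^ (-ρ) * 2 ^ ρ = 1 := by rw [← Real.rpow_add two_pos]; simp
  have hNinv : 1 ≤ (2 : ℝ) ^ (-ρ) * N := by
    rw [← hinv]
    gcongr
  have hfst : (1 - a * x) * N ≤ N - x * 2 ^ ρ * a := by
    linarith [mul_le_mul_of_nonneg_left hN (mul_nonneg ha hx)]
  have hsnd : (1 - b * 2 ^ (-ρ)) * N ≤ N - b := by
    linarith [mul_le_mul_of_nonneg_left hNinv hb]
  have hsnd₀ : 0 ≤ 1 - b * (2 : ℝ) ^ (-ρ) := by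
    rw [Real.rpow_neg two_pos.le, ← div_eq_mul_inv, sub_nonneg, div_le_one (by positivity)]
    linarith
  have hlog : ρ - 1 ≤ Real.logb 2 (N - b) := by
    rw [Real.le_logb_iff_rpow_le one_lt_two (by linarith), Real.rpow_sub_one two_ne_zero]
    linarith
  have hlog₀ : 0 ≤ Real.logb 2 (N - b) := Real.logb_nonneg one_lt_two (by linarith)
  calc (1 - a * x) * ((1 - b * 2 ^ (-ρ)) * (ρ - 1)) * N ^ 2
      = ((1 - a * x) * N) * (((1 - b * 2 ^ (-ρ)) * N) * (ρ - 1)) := by ring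
    _ ≤ ((1 - a * x) * N) * (((1 - b * 2 ^ (-ρ)) * N) * Real.logb 2 (N - b)) :=
        mul_le_mul_of_nonneg_left (mul_le_mul_of_nonneg_left hlog (mul_nonneg hsnd₀ hN₀.le))
          (mul_nonneg (by linarith) hN₀.le)
    _ ≤ (N - x * 2 ^ ρ * a) * ((N - b) * Real.logb 2 (N - b)) := by
        refine mul_le_mul hfst (mul_le_mul_of_nonneg_right hsnd hlog₀)
          (mul_nonneg (mul_nonneg hsnd₀ hN₀.le) hlog₀) ?_
        exact (mul_nonneg (by linarith) hN₀.le).trans hfst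

theorem eventually_card_le_two_rpow {m D : ℕ} {α M θ r : ℝ} {𝒮 : Finset (Finset (Fin (m + 2)))}
    (h𝒮 : ∀ S ∈ 𝒮, #S < m) (hD₀ : 0 < D) (hD : ∀ a, #{S ∈ 𝒮 | a ∈ S} = D)
    (hM : IsHashFormBound (Fin (m + 2)) m α M) (hθ : θ ∈ Set.Icc 0 1) (hr : 0 < r)
    (hbox : θ * Real.logb 2 (#𝒮 / D) < r) (hform : (1 - θ) * M < r) :
    ∀ᶠ n : ℕ in atTop, ∀ C, IsPerfectHash (m + 2) n C → (#C : ℝ) ≤ (2 : ℝ) ^ (r * n) := by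
  set s := θ * Real.logb 2 (#𝒮 / D)
  have hsmall {t : ℝ} (ht : t < 0) (a : ℝ) : ∀ᶠ n : ℕ in atTop, a * ((2 : ℝ) ^ t) ^ n < 1 / 2 :=
    (tendsto_const_mul_two_rpow_pow ht a).eventually_lt_const (by norm_num)
  filter_upwards [eventually_mul_lt_one_sub_mul_mul ((m : ℝ) ^ 2) m hr hbox hform,
    hsmall (sub_neg.2 hbox) ((m : ℝ) ^ 2), hsmall (neg_lt_zero.2 hr) (m + 1)] with n hlt hx hy C hC
  by_contra! hlarge
  have hinv : ((2 : ℝ) ^ (-r)) ^ n = 2 ^ (-(r * n)) := by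
    rw [← Real.rpow_mul_natCast two_pos.le, neg_mul]
  have hsplit : (2 : ℝ) ^ (s * n) = ((2 : ℝ) ^ (s - r)) ^ n * 2 ^ (r * n) := by
    rw [← Real.rpow_mul_natCast two_pos.le, ← Real.rpow_add two_pos]
    ring_nf
  rw [hinv] at hlt hy
  have hm₂ : 2 * ((m : ℝ) + 1) ≤ 2 ^ (r * n) := by
    rw [Real.rpow_neg two_pos.le, ← div_eq_mul_inv, div_lt_iff₀ (by positivity)] at hy
    linarith
  have hm : m < #C := by
    have h : (m : ℝ) < #C := by linarith [(Nat.cast_nonneg m : (0 : ℝ) ≤ m)]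
    exact_mod_cast h
  have hupper := hC.card_sub_two_rpow_mul_le hm h𝒮 hD₀ hD hM hθ
  rw [hsplit] at hupper
  have hlower := one_sub_mul_one_sub_mul_mul_sq_le (sq_nonneg (m : ℝ)) m.cast_nonneg
    (by positivity : 0 ≤ ((2 : ℝ) ^ (s - r)) ^ n) (by linarith) hm₂ hlarge.le
  have hcard : (0 : ℝ) < (#C : ℝ) ^ 2 := by
    have h : 0 < #C := by omega
    positivity
  linarith [mul_lt_mul_of_pos_right hlt hcard]

theorem hashRate_le_of_eventually {k : ℕ} {r : ℝ} (hr : 0 ≤ r)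
    (h : ∀ᶠ n : ℕ in atTop, ∀ C, IsPerfectHash k n C → (#C : ℝ) ≤ (2 : ℝ) ^ (r * n)) :
    hashRate k ≤ r := by
  classical
  refine limsup_le_of_le
    (IsCoboundedUnder.of_frequently_ge (.of_forall fun n ↦ maxHashRate_nonneg k n)) ?_
  filter_upwards [h, eventually_gt_atTop 0] with n hn hn₀
  have hsize : (maxHashSize k n : ℝ) ≤ (2 : ℝ) ^ (r * n) := by
    refine (Nat.le_floor_iff (by positivity)).1 (Finset.sup_le fun C hC ↦ ?_)
    exact Nat.le_floor (hn C (mem_filter.1 hC).2)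
  rw [maxHashRate, div_le_iff₀ (by exact_mod_cast hn₀)]
  rcases (maxHashSize k n).eq_zero_or_pos with hzero | hpos
  · rw [hzero]
    simpa using by positivity
  · rwa [Real.logb_le_iff_le_rpow one_lt_two (by exact_mod_cast hpos)]

theorem hashRate_le_max {m D : ℕ} {α M θ : ℝ} {𝒮 : Finset (Finset (Fin (m + 2)))}
    (h𝒮 : ∀ S ∈ 𝒮, #S < m) (hD₀ : 0 < D) (hD : ∀ a, #{S ∈ 𝒮 | a ∈ S} = D)
    (hM : IsHashFormBound (Fin (m + 2)) m α M) (hθ : θ ∈ Set.Icc 0 1) :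
    hashRate (m + 2) ≤ max (θ * Real.logb 2 (#𝒮 / D)) ((1 - θ) * M) := by
  refine le_of_forall_gt_imp_ge_of_dense fun r hr ↦ ?_
  obtain ⟨hbox, hform⟩ := max_lt_iff.1 hr
  have hr₀ : 0 < r := (mul_nonneg (sub_nonneg.2 hθ.2) hM.nonneg).trans_lt hform
  exact hashRate_le_of_eventually hr₀.le
    (eventually_card_le_two_rpow h𝒮 hD₀ hD hM hθ hr₀ hbox hform)

end Asymptotics

theorem mainTheorem1 :
    hashRate 5 ≤ 0.1697 ∧ hashRate 6 ≤ 0.0875 := by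
  constructor
  · have hlog : Real.logb 2 ((5 / 2) ^ 5) ≤ 7 :=
      (Real.logb_le_iff_le_rpow one_lt_two (by norm_num)).2 (by norm_num)
    rw [Real.logb_pow] at hlog
    refine (hashRate_le_max (m := 3) (𝒮 := powersetCard 2 univ) (D := 4) (θ := 3 / 25)
      (fun S hS ↦ by simp [(mem_powersetCard.1 hS).2]) (by norm_num) (by decide)
      (isHashFormBound_three (by simp)) (by norm_num)).trans (max_le ?_ (by norm_num))
    norm_num [card_powersetCard, Nat.choose] at hlog ⊢
    linarith
  · refine (hashRate_le_max (m := 4) (𝒮 := powersetCard 3 univ) (D := 10) (θ := 7 / 100)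
      (fun S hS ↦ by simp [(mem_powersetCard.1 hS).2]) (by norm_num) (by decide)
      (isHashFormBound_four (by simp)) (by norm_num)).trans (max_le ?_ (by norm_num))
    norm_num [card_powersetCard, Nat.choose]
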